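/- Let $A\subseteq\mathbb{Q}$ be any subset, and let $\mathbb{V}$ be the infinite strip $\mathbb{R}\times[0,1]$ with vertices $(i,0)$, $i\in\mathbb{Z}$, on the lower boundary, vertices $(q,1)$, $q\in A$, on the upper boundary, and two limit points $-\infty$ and $+\infty$ at the left and right ends of the strip. Arcs are isotopy classes of curves in $\mathbb{V}$ joining two distinct points among the vertices and the two limit points (arcs to a limit point are asymptotic arcs; the one joining the two limit points is the generic arc); segments of the upper or lower boundary between neighbouring vertices are not counted as arcs. Two arcs are compatible if they have representatives that do not cross. A triangulation $T$ of $\mathbb{V}$ is a maximal collection of pairwise compatible arcs, and it is admissible if every lower vertex $(i,0)$ is incident with only finitely many arcs of $T$. The triangles of $T$ are those whose sides are arcs of $T$ or boundary segments; limit points are allowed as corners. For $i\le j$, let $\mathcal{M}_{ij}$ be the set of matchings between the vertices $(i,0),(i+1,0),\dots,(j,0)$ and the triangles of $T$, that is, of assignments to each of these vertices of a triangle of $T$ incident with it, such that distinct vertices receive distinct triangles. An infinite frieze is an array of integers $(m_{ij})_{i,j\in\mathbb{Z},\,j\ge i-2}$ with $m_{i,i-2}=0$, $m_{i,i-1}=1$,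 $m_{ij}>0$ for $i\le j$, and $m_{ij}m_{i+1,j+1}-m_{i+1,j}m_{i,j+1}=1$ for all $j\ge i-1$; its quiddity row is $(m_{ii})_{i\in\mathbb{Z}}$. **Theorem.** Let $T$ be an admissible triangulation of $\mathbb{V}$ and, for every $i\in\mathbb{Z}$, let $a_i$ be the number of triangles of $T$ incident with $(i,0)$. Then the $a_i$ and all $|\mathcal{M}_{ij}|$ ($i\le j$) are finite, $(a_i)_{i\in\mathbb{Z}}$ is the quiddity row of an infinite frieze $\mathcal{F}=(m_{ij})_{i,j}$, and $m_{ij}=|\mathcal{M}_{ij}|$ for all $i\le j$ (for every infinite frieze $\mathcal{F}$ with this quiddity row). -/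

import Mathlib

namespace InfiniteStrip

/-- The points at which arcs of the strip `ℝ × [0,1]` may end: the vertices `(i, 0)`, `i ∈ ℤ`, on the
lower boundary, the vertices `(q, 1)`, `q ∈ A ⊆ ℚ`, on the upper boundary, and the two limit
points at the left and right extremities of the strip. -/
inductive Pt (A : Set ℚ) : Type
  | lower (i : ℤ) : Pt A
  | upper (q : A) : Pt A
  | negInf : Pt A
  | posInf : Pt A

namespace Pt

/-- The strip together with its two limit points is a disc, with all points of `Pt A` on its
boundary circle. `x.Before y` means that `x` is met before `y` when one runs once around this circle
anticlockwise, starting at `-∞`: first along the lower boundary from left to right, then through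
`+∞`, then along the upper boundary from right to left. -/
def Before {A : Set ℚ} : Pt A → Pt A → Prop
  | negInf, negInf => False
  | negInf, _ => True
  | lower _, negInf => False
  | lower i, lower j => i < j
  | lower _, posInf => True
  | lower _, upper _ => True
  | posInf, upper _ => True
  | posInf, _ => False
  | upper p, upper q => (q : ℚ) < p
  | upper _, _ => False

end Pt

variable {A : Set ℚ}

/-- The boundary segments: `e` joins two neighbouring vertices of the lower boundary, or two
neighbouring vertices of the upper boundary. -/
def IsBoundarySegment (e : Sym2 (Pt A)) : Prop :=
  (∃ i : ℤ, e = s(Pt.lower i, Pt.lower (i + 1))) ∨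
  (∃ p q : A, (p : ℚ) < q ∧ (∀ r ∈ A, ¬ ((p : ℚ) < r ∧ r < q)) ∧ e = s(Pt.upper p, Pt.upper q))

/-- Arcs. As the strip is simply connected with all marked points on its boundary, an isotopy class of
curves is given by its two distinct end points; the classes of the boundary segments are not arcs.
So there are bridging arcs (`lower`-`upper`), peripheral arcs (`lower`-`lower`, `upper`-`upper`),
asymptotic arcs (a vertex and a limit point) and the generic arc (the two limit points). -/
def IsArc (e : Sym2 (Pt A)) : Prop :=
  ¬ e.IsDiag ∧ ¬ IsBoundarySegment e

/-- `e` and `f` cross: their end points are four distinct points which alternate along the boundary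
circle. -/
def Crosses (e f : Sym2 (Pt A)) : Prop :=
  ∃ a b c d : Pt A, a.Before b ∧ b.Before c ∧ c.Before d ∧
    ((e = s(a, c) ∧ f = s(b, d)) ∨ (e = s(b, d) ∧ f = s(a, c)))

/-- Two arcs are compatible if they have representatives that do not meet outside their end points. -/
def Compatible (e f : Sym2 (Pt A)) : Prop :=
  ¬ Crosses e f

/-- A collection of pairwise compatible arcs. -/
def IsCompatibleCollection (T : Set (Sym2 (Pt A))) : Prop :=
  (∀ e ∈ T, IsArc e) ∧ T.Pairwise Compatible

/-- A triangulation of the strip: a maximal collection of pairwise compatible arcs. -/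
def IsTriangulation (T : Set (Sym2 (Pt A))) : Prop :=
  Maximal IsCompatibleCollection T

/-- An admissible triangulation: every lower vertex is incident with only finitely many arcs. -/
def IsAdmissibleTriangulation (T : Set (Sym2 (Pt A))) : Prop :=
  IsTriangulation T ∧ ∀ i : ℤ, {e ∈ T | Pt.lower i ∈ e}.Finite

/-- The triangles of `T`, given by their corners: three points, any two of which are joined by an arc
of `T` or by a boundary segment. (No arc of `T` can run through the interior of such a triangle,
because it would cross one of the sides.) -/
def IsTriangle (T : Set (Sym2 (Pt A))) (t : Finset (Pt A)) : Prop :=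
  t.card = 3 ∧ ∀ x ∈ t, ∀ y ∈ t, x ≠ y → (s(x, y) ∈ T ∨ IsBoundarySegment s(x, y))

/-- The set of triangles of `T` incident with the lower vertex `(i, 0)`. -/
def trianglesAt (T : Set (Sym2 (Pt A))) (i : ℤ) : Set (Finset (Pt A)) :=
  {t | IsTriangle T t ∧ Pt.lower i ∈ t}

/-- The set of matchings between the vertices `(i, 0), …, (j, 0)` and the triangles of `T`: each of
these vertices is assigned a triangle incident with it, distinct vertices being assigned distinct
triangles. -/
def matchings (T : Set (Sym2 (Pt A))) (i j : ℤ) : Set (Set.Icc i j → Finset (Pt A)) :=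
  {f | Function.Injective f ∧ ∀ k : Set.Icc i j, f k ∈ trianglesAt T k}

/-- Infinite friezes of positive integers. Only the entries `m i j` with `i - 2 ≤ j` belong to the
array. -/
def IsInfiniteFrieze (m : ℤ → ℤ → ℤ) : Prop :=
  (∀ i, m i (i - 2) = 0) ∧ (∀ i, m i (i - 1) = 1) ∧ (∀ i j, i ≤ j → 0 < m i j) ∧
  (∀ i j, i - 1 ≤ j → m i j * m (i + 1) (j + 1) - m (i + 1) j * m i (j + 1) = 1)

/-- `a` is the quiddity row (first non-trivial row) of the array `m`. -/
def IsQuiddityRow (m : ℤ → ℤ → ℤ) (a : ℤ → ℤ) : Prop :=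
  ∀ i, m i i = a i

end InfiniteStrip

/-! Order the marked points along the boundary circle, cut open at `-∞`, and let `N` be the
vertex-triangle incidence matrix with sign `-1` where the vertex is the middle corner of the
triangle. Restrict the Gram matrix of `N` to the rows `i, …, j`. Its diagonal entries are the `a_k`.
If `k < l` are joined by an edge, the triangle above the edge contributes `-1` (exactly one of `k`,
`l` is its middle corner); the triangle below, present unless `l = k + 1`, contributes `+1`. So the
Gram matrix is tridiagonal, with `-1` beside the diagonal (`sum_cornerSign_mul`).

Expanding its determinant as in Cauchy-Binet gives a sum over injective choices of incident
triangles. Each contributes `1`, because a matching is determined by its set of triangles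
(`perm_eq_one_of_matchings`), which leaves only the identity term in each minor. Hence `|M_ij|` is a
continuant in the `a_k` (`ncard_matchings`).

Continuants satisfy the frieze rule. Positivity holds since every lower vertex is the middle corner
of some triangle (`exists_middle`), and positivity makes the frieze unique by division. -/

namespace InfiniteStrip

/-! ### Continuants and the unimodular rule -/

/-- The tridiagonal matrix with diagonal `a i, a (i + 1), …` and all neighbouring entries `-1`. -/
def tridiagonal (a : ℤ → ℤ) (i : ℤ) (n : ℕ) : Matrix (Fin n) (Fin n) ℤ :=
  Matrix.of fun p q => if p = q then a (i + (p : ℕ)) else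
    if (p : ℕ) + 1 = q ∨ (q : ℕ) + 1 = p then -1 else 0

theorem det_tridiagonal_zero (a : ℤ → ℤ) (i : ℤ) : (tridiagonal a i 0).det = 1 := by simp

theorem det_tridiagonal_one (a : ℤ → ℤ) (i : ℤ) : (tridiagonal a i 1).det = a i := by
  simp [tridiagonal]

theorem det_tridiagonal_add_two (a : ℤ → ℤ) (i : ℤ) (n : ℕ) :
    (tridiagonal a i (n + 2)).det =
      a i * (tridiagonal a (i + 1) (n + 1)).det - (tridiagonal a (i + 2) n).det := by
  have h₀ : (tridiagonal a i (n + 2)).submatrix Fin.succ (Fin.succAbove 0) =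
      tridiagonal a (i + 1) (n + 1) := by
    ext p q
    simp [tridiagonal, add_assoc, add_comm (1 : ℤ)]
  have h₁ : ((tridiagonal a i (n + 2)).submatrix Fin.succ (Fin.succAbove 1)).det =
      - (tridiagonal a (i + 2) n).det := by
    rw [Matrix.det_succ_column_zero, Fin.sum_univ_succ, Finset.sum_eq_zero]
    · have : ((tridiagonal a i (n + 2)).submatrix Fin.succ (Fin.succAbove 1)).submatrix
          (Fin.succAbove 0) Fin.succ = tridiagonal a (i + 2) n := by
        ext p q
        have : (Fin.succAbove (1 : Fin (n + 2)) q.succ) = q.succ.succ := by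
          rw [Fin.succAbove_of_le_castSucc]; simp [Fin.le_def]
        simp [tridiagonal, add_assoc, this]
        congr 2
        ring
      rw [this]
      simp [tridiagonal]
    · intro p _
      simp [tridiagonal]
  rw [Matrix.det_succ_row_zero, Fin.sum_univ_succ, Fin.sum_univ_succ, Finset.sum_eq_zero]
  · rw [h₀]
    have : Fin.succ (0 : Fin (n + 1)) = 1 := rfl
    rw [this, h₁]
    simp [tridiagonal]
    ring
  · intro p _
    simp [tridiagonal, Fin.ext_iff]

/-- Expanding the two determinants that start at `i` by the three-term recursion cancels the terms
with `a i` and leaves the same identity one place to the right, one size smaller. -/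
theorem det_tridiagonal_unimodular (a : ℤ → ℤ) (n : ℕ) (i : ℤ) :
    (tridiagonal a i (n + 1)).det * (tridiagonal a (i + 1) (n + 1)).det -
      (tridiagonal a (i + 1) n).det * (tridiagonal a i (n + 2)).det = 1 := by
  induction n generalizing i with
  | zero =>
    rw [det_tridiagonal_add_two]
    rw [det_tridiagonal_zero, det_tridiagonal_zero, det_tridiagonal_one, det_tridiagonal_one]
    ring
  | succ n ih =>
    have h := ih (i + 1)
    rw [show i + 1 + 1 = i + 2 by ring] at h
    rw [det_tridiagonal_add_two a i (n + 1), det_tridiagonal_add_two a i n]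
    linear_combination h

/-! ### A Gram determinant counting distinct representatives -/

open Finset in
/-- If every system of distinct representatives is determined by its set of values, then the Gram
determinant of a signed incidence matrix counts the systems of distinct representatives. -/
theorem det_gram_eq_card {ι τ : Type*} [Fintype ι] [DecidableEq ι] [DecidableEq τ]
    (N : ι → τ → ℤ) (F : ι → Finset τ) (hN : ∀ k, ∀ t ∈ F k, N k t * N k t = 1)
    (hF : ∀ k l, ∀ t ∈ F l, N k t ≠ 0 → t ∈ F k)
    (huniq : ∀ f : ι → τ, Function.Injective f → (∀ k, f k ∈ F k) → ∀ σ : Equiv.Perm ι,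
      (∀ k, f (σ k) ∈ F k) → σ = 1) :
    (Matrix.of fun k l => ∑ t ∈ F k, N k t * N l t).det =
      (({f ∈ Fintype.piFinset F | Function.Injective f} : Finset (ι → τ)).card : ℤ) := by
  -- Row `k` is the sum over `t ∈ F k` of `N k t` times column `t` of `N`; multilinearity in the
  -- rows gives one term per choice function.
  have h₁ : (Matrix.of fun k l => ∑ t ∈ F k, N k t * N l t).det =
      ∑ f ∈ Fintype.piFinset F,
        (∏ k, N k (f k)) * (Matrix.of fun k l => N l (f k)).det := by
    have : (Matrix.of fun k l => ∑ t ∈ F k, N k t * N l t) =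
        fun k => ∑ t ∈ F k, N k t • (fun l => N l t) := by
      ext k l
      simp
    rw [this]
    change Matrix.detRowAlternating.toMultilinearMap _ = _
    rw [MultilinearMap.map_sum_finset]
    refine sum_congr rfl fun f _ => ?_
    rw [MultilinearMap.map_smul_univ]
    rfl
  rw [h₁, card_filter, Nat.cast_sum]
  refine sum_congr rfl fun f hf => ?_
  rw [Fintype.mem_piFinset] at hf
  split_ifs with hinj
  -- A nonzero Leibniz term for `σ` would make `f ∘ σ` a second system with the same values, so only
  -- the identity survives.
  · have h₂ : (Matrix.of fun k l => N l (f k)).det = ∏ k, N k (f k) := by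
      rw [Matrix.det_apply, sum_eq_single 1]
      · simp
      · intro σ _ hσ
        have : ∃ k, N k (f (σ k)) = 0 := by
          by_contra! hne
          exact hσ (huniq f hinj hf σ fun k => hF _ _ _ (hf (σ k)) (hne k))
        obtain ⟨k, hk⟩ := this
        rw [prod_eq_zero (mem_univ k) (by simpa using hk), smul_zero]
      · simp
    rw [h₂, ← prod_mul_distrib, prod_eq_one fun k _ => hN k _ (hf k)]
    simp
  · have : ∃ k l, f k = f l ∧ k ≠ l := by simpa [Function.Injective] using hinj
    obtain ⟨k, l, hkl, hne⟩ := this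
    rw [Matrix.det_zero_of_row_eq hne (by ext; simp [hkl])]
    simp

/-! ### The circular order, edges and maximality -/

variable {A : Set ℚ}

/-- The position of a point on the boundary circle, cut open at `-∞`. -/
def Pt.key : Pt A → ℕ ×ₗ ℚ
  | .negInf => toLex (0, 0)
  | .lower i => toLex (1, (i : ℚ))
  | .posInf => toLex (2, 0)
  | .upper q => toLex (3, -(q : ℚ))

theorem Pt.key_injective : Function.Injective (Pt.key (A := A)) := by
  intro x y h
  cases x <;> cases y <;> simp [Pt.key, Subtype.ext_iff] at h ⊢ <;> exact h

noncomputable instance : LinearOrder (Pt A) := LinearOrder.lift' Pt.key Pt.key_injective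

theorem Pt.lt_iff_key {x y : Pt A} : x < y ↔ x.key < y.key := Iff.rfl

theorem Pt.before_iff_lt {x y : Pt A} : x.Before y ↔ x < y := by
  rw [Pt.lt_iff_key]
  cases x <;> cases y <;> simp [Pt.key, Pt.Before, Prod.Lex.toLex_lt_toLex]

@[simp] theorem lower_lt_lower {k l : ℤ} : (Pt.lower k : Pt A) < Pt.lower l ↔ k < l := by
  rw [← Pt.before_iff_lt]; rfl

@[simp] theorem lower_le_lower {k l : ℤ} : (Pt.lower k : Pt A) ≤ Pt.lower l ↔ k ≤ l := by
  rw [← not_lt, lower_lt_lower, not_lt]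

theorem exists_eq_lower {k l : ℤ} {x : Pt A} (h₁ : Pt.lower k ≤ x) (h₂ : x ≤ Pt.lower l) :
    ∃ m, x = Pt.lower m := by
  rw [← not_lt, ← Pt.before_iff_lt] at h₁ h₂
  cases x <;> simp [Pt.Before] at h₁ h₂ ⊢

/-- `x` and `y` are joined by an arc of `T` or by a boundary segment. -/
def Edge (T : Set (Sym2 (Pt A))) (x y : Pt A) : Prop :=
  s(x, y) ∈ T ∨ IsBoundarySegment s(x, y)

variable {T : Set (Sym2 (Pt A))}

theorem Edge.symm {x y : Pt A} (h : Edge T x y) : Edge T y x := by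
  unfold Edge at *; rwa [Sym2.eq_swap]

theorem edge_succ (k : ℤ) : Edge T (Pt.lower k) (Pt.lower (k + 1)) := Or.inr (Or.inl ⟨k, rfl⟩)

theorem edge_pred (k : ℤ) : Edge T (Pt.lower k) (Pt.lower (k - 1)) := by
  have := edge_succ (T := T) (k - 1)
  rw [sub_add_cancel] at this
  exact this.symm

/-- The ends of a boundary segment are neighbours on the circle. -/
theorem IsBoundarySegment.not_between {a b c : Pt A} (h : IsBoundarySegment s(a, c))
    (hab : a < b) (hbc : b < c) : False := by
  rw [← Pt.before_iff_lt] at hab hbc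
  rcases h with ⟨i, h⟩ | ⟨p, q, hpq, hr, h⟩
  · rcases Sym2.eq_iff.1 h with ⟨rfl, rfl⟩ | ⟨rfl, rfl⟩ <;> cases b <;>
      simp [Pt.Before] at hab hbc <;> omega
  · rcases Sym2.eq_iff.1 h with ⟨rfl, rfl⟩ | ⟨rfl, rfl⟩ <;> cases b <;>
      simp [Pt.Before] at hab hbc
    · exact lt_asymm hpq (lt_trans (α := ℚ) hbc hab)
    · exact hr _ (Subtype.property _) ⟨hbc, hab⟩

theorem edge_not_cross (hT : IsTriangulation T) {a b c d : Pt A} (hac : Edge T a c)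
    (hbd : Edge T b d) (hab : a < b) (hbc : b < c) (hcd : c < d) : False := by
  rcases hac with hac | hac
  · rcases hbd with hbd | hbd
    · have hne : s(a, c) ≠ s(b, d) := by
        intro h
        rcases Sym2.eq_iff.1 h with ⟨rfl, -⟩ | ⟨rfl, -⟩
        · exact lt_irrefl _ hab
        · exact lt_irrefl _ ((hab.trans hbc).trans hcd)
      refine hT.prop.2 hac hbd hne ⟨a, b, c, d, ?_, ?_, ?_, Or.inl ⟨rfl, rfl⟩⟩ <;>
        rwa [Pt.before_iff_lt]
    · exact hbd.not_between hbc hcd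
  · exact hac.not_between hab hbc

theorem crosses_symm {e f : Sym2 (Pt A)} (h : Crosses e f) : Crosses f e := by
  obtain ⟨a, b, c, d, h₁, h₂, h₃, h⟩ := h
  exact ⟨a, b, c, d, h₁, h₂, h₃, by tauto⟩

/-- By maximality, two points that no edge separates are joined by an edge. -/
theorem edge_of_uncrossed (hT : IsTriangulation T) {x y : Pt A} (hxy : x < y)
    (h : ∀ u v, Edge T u v → x < u → u < y → x ≤ v ∧ v ≤ y) : Edge T x y := by
  by_cases hb : IsBoundarySegment s(x, y)
  · exact Or.inr hb
  refine Or.inl ?_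
  have hun : ∀ e ∈ T, ¬ Crosses s(x, y) e := by
    rintro e he ⟨a, b, c, d, h₁, h₂, h₃, hh⟩
    rw [Pt.before_iff_lt] at h₁ h₂ h₃
    rcases hh with ⟨hxy', rfl⟩ | ⟨hxy', rfl⟩
    · rcases Sym2.eq_iff.1 hxy' with ⟨rfl, rfl⟩ | ⟨rfl, rfl⟩
      · exact absurd (h b d (Or.inl he) h₁ h₂).2 (not_le.2 h₃)
      · exact lt_asymm hxy (h₁.trans h₂)
    · rcases Sym2.eq_iff.1 hxy' with ⟨rfl, rfl⟩ | ⟨rfl, rfl⟩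
      · exact absurd (h c a (Edge.symm (Or.inl he)) h₂ h₃).1 (not_le.2 h₁)
      · exact lt_asymm hxy (h₂.trans h₃)
  have hcol : IsCompatibleCollection (insert s(x, y) T) := by
    refine ⟨?_, ?_⟩
    · rintro e (rfl | he)
      · exact ⟨by simpa using hxy.ne, hb⟩
      · exact hT.prop.1 e he
    · refine hT.prop.2.insert fun e he _ => ⟨hun e he, fun hc => hun e he (crosses_symm hc)⟩
  exact hT.le_of_ge hcol (Set.subset_insert _ _) (Set.mem_insert _ _)

theorem Edge.ne (hT : IsTriangulation T) {x y : Pt A} (h : Edge T x y) : x ≠ y := by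
  rintro rfl
  rcases h with h | ⟨i, h⟩ | ⟨p, q, hpq, -, h⟩
  · exact (hT.prop.1 _ h).1 rfl
  · rcases Sym2.eq_iff.1 h with ⟨rfl, h⟩ | ⟨rfl, h⟩ <;> simp at h
  · rcases Sym2.eq_iff.1 h with ⟨rfl, h⟩ | ⟨rfl, h⟩ <;> simp at h <;> subst h <;>
      exact lt_irrefl _ hpq

/-- This is where admissibility enters: it supplies the extremal neighbours from which triangles are
built. -/
theorem finite_nbrs (hT : IsAdmissibleTriangulation T) (k : ℤ) :
    {x | Edge T (Pt.lower k) x}.Finite := by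
  have h₁ : {x | s(Pt.lower k, x) ∈ T}.Finite := by
    refine ((hT.2 k).preimage (f := fun x => s(Pt.lower k, x)) ?_).subset ?_
    · intro x _ y _ h
      exact Sym2.congr_right.1 h
    · intro x hx
      exact ⟨hx, by simp⟩
  refine (h₁.union (Set.toFinite {Pt.lower (k - 1), Pt.lower (k + 1)})).subset ?_
  rintro x (hx | ⟨i, h⟩ | ⟨p, q, -, -, h⟩)
  · exact Or.inl hx
  · rcases Sym2.eq_iff.1 h with ⟨h', rfl⟩ | ⟨h', rfl⟩ <;> obtain rfl := Pt.lower.inj h' <;> simp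
  · rcases Sym2.eq_iff.1 h with ⟨h', -⟩ | ⟨h', -⟩ <;> exact Pt.noConfusion rfl (heq_of_eq h')

theorem exists_min_nbr (hT : IsAdmissibleTriangulation T) {k : ℤ} (P : Pt A → Prop)
    (h : ∃ x, Edge T (Pt.lower k) x ∧ P x) :
    ∃ x, Edge T (Pt.lower k) x ∧ P x ∧ ∀ y, Edge T (Pt.lower k) y → P y → x ≤ y := by
  obtain ⟨x, ⟨hx, hP⟩, hmin⟩ := Set.exists_min_image {x | Edge T (Pt.lower k) x ∧ P x} id
    ((finite_nbrs hT k).subset fun _ h => h.1) h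
  exact ⟨x, hx, hP, fun y hy hPy => hmin y ⟨hy, hPy⟩⟩

theorem exists_max_nbr (hT : IsAdmissibleTriangulation T) {k : ℤ} (P : Pt A → Prop)
    (h : ∃ x, Edge T (Pt.lower k) x ∧ P x) :
    ∃ x, Edge T (Pt.lower k) x ∧ P x ∧ ∀ y, Edge T (Pt.lower k) y → P y → y ≤ x := by
  obtain ⟨x, ⟨hx, hP⟩, hmax⟩ := Set.exists_max_image {x | Edge T (Pt.lower k) x ∧ P x} id
    ((finite_nbrs hT k).subset fun _ h => h.1) h
  exact ⟨x, hx, hP, fun y hy hPy => hmax y ⟨hy, hPy⟩⟩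

/-! ### Triangles at an edge and at a lower vertex -/

/-- The triangle below an edge between lower vertices. -/
theorem exists_below (hT : IsAdmissibleTriangulation T) {k l : ℤ}
    (hkl : Edge T (Pt.lower k) (Pt.lower l)) (hlt : k + 1 < l) :
    ∃ m, k < m ∧ m < l ∧ Edge T (Pt.lower k) (Pt.lower m) ∧ Edge T (Pt.lower m) (Pt.lower l) := by
  obtain ⟨x, hx, ⟨h₁, h₂⟩, hmax⟩ := exists_max_nbr hT (k := k)
    (fun x => Pt.lower k < x ∧ x < Pt.lower l) ⟨_, edge_succ k, by simp, by simpa⟩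
  obtain ⟨m, rfl⟩ := exists_eq_lower h₁.le h₂.le
  refine ⟨m, by simpa using h₁, by simpa using h₂, hx, edge_of_uncrossed hT.1 h₂ ?_⟩
  intro u v huv hu₁ hu₂
  have c := @edge_not_cross A T hT.1
  have hs := huv.symm
  refine ⟨?_, ?_⟩
  · by_contra! hv
    rcases lt_trichotomy v (Pt.lower k) with h | rfl | h
    · exact c hs hkl h (h₁.trans hu₁) hu₂
    · exact absurd (hmax u hs ⟨h₁.trans hu₁, hu₂⟩) (not_le.2 hu₁)
    · exact c hx hs h hv hu₁
  · by_contra! hv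
    exact c hkl huv (h₁.trans hu₁) hu₂ hv

/-- The triangle above an edge between lower vertices. -/
theorem exists_above (hT : IsAdmissibleTriangulation T) {k l : ℤ}
    (hkl : Edge T (Pt.lower k) (Pt.lower l)) (hlt : k < l) :
    ∃ y, (y < Pt.lower k ∨ Pt.lower l < y) ∧ Edge T (Pt.lower k) y ∧ Edge T (Pt.lower l) y := by
  have c := @edge_not_cross A T hT.1
  have hlt' : (Pt.lower k : Pt A) < Pt.lower l := by simpa
  -- The apex is the first neighbour of `k` met after `l` on the circle. If none lies between `l`
  -- and the cut at `-∞`, the search resumes from the cut and finds the smallest neighbour of `k`.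
  by_cases hex : ∃ x, Edge T (Pt.lower k) x ∧ Pt.lower l < x
  · obtain ⟨y, hy, hly, hmin⟩ := exists_min_nbr hT _ hex
    refine ⟨y, Or.inr hly, hy, edge_of_uncrossed hT.1 hly ?_⟩
    intro u v huv hu₁ hu₂
    have hs := huv.symm
    refine ⟨?_, ?_⟩
    · by_contra! hv
      rcases lt_trichotomy v (Pt.lower k) with h | rfl | h
      · exact c hs hy h (hlt'.trans hu₁) hu₂
      · exact absurd (hmin u hs hu₁) (not_le.2 hu₂)
      · exact c hkl hs h hv hu₁
    · by_contra! hv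
      exact c hy huv (hlt'.trans hu₁) hu₂ hv
  · push Not at hex
    obtain ⟨y, hy, hky, hmin⟩ := exists_min_nbr hT (k := k) (fun x => x < Pt.lower k)
      ⟨_, edge_pred k, by simp⟩
    refine ⟨y, Or.inl hky, hy, (edge_of_uncrossed hT.1 (hky.trans hlt') ?_).symm⟩
    intro u v huv hu₁ hu₂
    have hs := huv.symm
    rcases lt_trichotomy u (Pt.lower k) with h | rfl | h
    · exact ⟨le_of_not_gt fun hv => c hs hy.symm hv hu₁ h,
        le_of_not_gt fun hv => c hy.symm huv hu₁ h (hlt'.trans hv)⟩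
    · refine ⟨le_of_not_gt fun hv => ?_, hex v huv⟩
      exact absurd (hmin v huv (hv.trans hky)) (not_le.2 hv)
    · exact ⟨le_of_not_gt fun hv => c hs hkl (hv.trans hky) h hu₂,
        le_of_not_gt fun hv => c hkl huv h hu₂ hv⟩

/-- Every lower vertex is the middle corner of a triangle. -/
theorem exists_middle (hT : IsAdmissibleTriangulation T) (k : ℤ) :
    ∃ x z, x < Pt.lower k ∧ Pt.lower k < z ∧ Edge T x (Pt.lower k) ∧ Edge T (Pt.lower k) z ∧
      Edge T x z := by
  have c := @edge_not_cross A T hT.1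
  -- The smallest and the largest neighbour of `k` are consecutive around `k`, on either side of the
  -- cut; an edge separating them would cross an edge at `k` or give a more extreme neighbour.
  obtain ⟨x, hx, hxk, hmin⟩ := exists_min_nbr hT (k := k) (fun x => x < Pt.lower k)
    ⟨_, edge_pred k, by simp⟩
  obtain ⟨z, hz, hkz, hmax⟩ := exists_max_nbr hT (k := k) (fun x => Pt.lower k < x)
    ⟨_, edge_succ k, by simp⟩
  refine ⟨x, z, hxk, hkz, hx.symm, hz, edge_of_uncrossed hT.1 (hxk.trans hkz) ?_⟩
  intro u v huv hu₁ hu₂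
  have hs := huv.symm
  rcases lt_trichotomy u (Pt.lower k) with h | rfl | h
  · exact ⟨le_of_not_gt fun hv => c hs hx.symm hv hu₁ h,
      le_of_not_gt fun hv => c hx.symm huv hu₁ h (hkz.trans hv)⟩
  · exact ⟨le_of_not_gt fun hv => absurd (hmin v huv (hv.trans hxk)) (not_le.2 hv),
      le_of_not_gt fun hv => absurd (hmax v huv (hkz.trans hv)) (not_le.2 hv)⟩
  · exact ⟨le_of_not_gt fun hv => c hs hz (hv.trans hxk) h hu₂,
      le_of_not_gt fun hv => c hz huv h hu₂ hv⟩

theorem below_unique (hT : IsTriangulation T) {k l y y' : Pt A} (hy₁ : k < y) (hy₂ : y < l)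
    (hy'₁ : k < y') (hy'₂ : y' < l) (h₁ : Edge T k y) (h₂ : Edge T y l) (h₁' : Edge T k y')
    (h₂' : Edge T y' l) : y = y' := by
  rcases lt_trichotomy y y' with h | h | h
  · exact (edge_not_cross hT h₁' h₂ hy₁ h hy'₂).elim
  · exact h
  · exact (edge_not_cross hT h₁ h₂' hy'₁ h hy₂).elim

/-- Two apexes on one side of an edge would give crossing sides. The upper side is a single arc of
the circle, but the cut splits it into two intervals, hence the cases. -/
theorem above_unique (hT : IsTriangulation T) {k l y y' : Pt A} (hkl : k < l)
    (hy : y < k ∨ l < y) (hy' : y' < k ∨ l < y') (h₁ : Edge T k y) (h₂ : Edge T l y)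
    (h₁' : Edge T k y') (h₂' : Edge T l y') : y = y' := by
  have c := @edge_not_cross A T hT
  by_contra hne
  rcases hy with hy | hy <;> rcases hy' with hy' | hy' <;> rcases lt_or_gt_of_ne hne with h | h
  · exact c h₁.symm h₂'.symm h hy' hkl
  · exact c h₁'.symm h₂.symm h hy hkl
  · exact c h₂.symm h₁' hy hkl hy'
  · exact absurd ((hy.trans hkl).trans hy') (lt_asymm h)
  · exact absurd ((hy'.trans hkl).trans hy) (lt_asymm h)
  · exact c h₂'.symm h₁ hy' hkl hy
  · exact c h₁ h₂' hkl hy h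
  · exact c h₁' h₂ hkl hy' h

theorem IsTriangle.edge {t : Finset (Pt A)} (ht : IsTriangle T t) {x y : Pt A} (hx : x ∈ t)
    (hy : y ∈ t) (hxy : x ≠ y) : Edge T x y := ht.2 x hx y hy hxy

theorem IsTriangle.exists_third {t : Finset (Pt A)} (ht : IsTriangle T t) {x y : Pt A}
    (hx : x ∈ t) (hy : y ∈ t) (hxy : x ≠ y) : ∃ z, z ≠ x ∧ z ≠ y ∧ t = {x, y, z} := by
  have h : ((t.erase x).erase y).card = 1 := by
    rw [Finset.card_erase_of_mem (by simp [hy, hxy.symm]), Finset.card_erase_of_mem hx, ht.1]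
  obtain ⟨z, hz⟩ := Finset.card_eq_one.1 h
  have hz' : z ∈ (t.erase x).erase y := by simp [hz]
  simp only [Finset.mem_erase] at hz'
  refine ⟨z, hz'.2.1, hz'.1, ?_⟩
  rw [← hz, Finset.insert_erase (by simp [hy, hxy.symm]), Finset.insert_erase hx]

theorem isTriangle_of_edges (hT : IsTriangulation T) {x y z : Pt A} (hxy : Edge T x y)
    (hxz : Edge T x z) (hyz : Edge T y z) : IsTriangle T {x, y, z} := by
  refine ⟨Finset.card_eq_three.2 ⟨x, y, z, hxy.ne hT, hxz.ne hT, hyz.ne hT, rfl⟩, ?_⟩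
  intro u hu v hv huv
  simp only [Finset.mem_insert, Finset.mem_singleton] at hu hv
  change Edge T u v
  rcases hu with rfl | rfl | rfl <;> rcases hv with rfl | rfl | rfl <;>
    first | exact absurd rfl huv | assumption | (apply Edge.symm; assumption)

theorem finite_trianglesAt (hT : IsAdmissibleTriangulation T) (k : ℤ) :
    (trianglesAt T k).Finite := by
  refine ((finite_nbrs hT k).insert (Pt.lower k)).toFinset.powerset.finite_toSet.subset ?_
  rintro t ⟨ht, hk⟩
  rw [Finset.mem_coe, Finset.mem_powerset]
  intro x hx
  rw [Set.Finite.mem_toFinset]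
  by_cases h : x = Pt.lower k
  · exact Or.inl h
  · exact Or.inr (ht.edge hk hx (Ne.symm h))

/-- Two triangles that share an edge between lower vertices and lie on its upper side agree. -/
theorem triangle_above_unique (hT : IsTriangulation T) {t t' : Finset (Pt A)} {k l : Pt A}
    (hkl : k < l) (ht : IsTriangle T t) (ht' : IsTriangle T t') (hk : k ∈ t) (hl : l ∈ t)
    (hk' : k ∈ t') (hl' : l ∈ t') (h : ¬ ∀ x ∈ t, k ≤ x ∧ x ≤ l)
    (h' : ¬ ∀ x ∈ t', k ≤ x ∧ x ≤ l) : t = t' := by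
  obtain ⟨y, hyk, hyl, rfl⟩ := ht.exists_third hk hl hkl.ne
  obtain ⟨y', hyk', hyl', rfl⟩ := ht'.exists_third hk' hl' hkl.ne
  have hy : y < k ∨ l < y := by
    simp [hkl.le] at h; by_contra! hc; exact absurd hc.2 (not_le.2 (h hc.1))
  have hy' : y' < k ∨ l < y' := by
    simp [hkl.le] at h'; by_contra! hc; exact absurd hc.2 (not_le.2 (h' hc.1))
  rw [above_unique hT hkl hy hy' (ht.edge hk (by simp) hyk.symm)
    (ht.edge hl (by simp) hyl.symm) (ht'.edge hk' (by simp) hyk'.symm)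
    (ht'.edge hl' (by simp) hyl'.symm)]

/-! ### A matching is determined by its triangles -/

/-- The triangles under an edge between lower vertices are all used up by the vertices strictly
under this edge. -/
theorem exists_matched_of_below (hT : IsAdmissibleTriangulation T) {i j : ℤ}
    {f : Set.Icc i j → Finset (Pt A)} (hf : f ∈ matchings T i j) (n : ℕ) {k l : ℤ}
    (hn : l - k ≤ n) (hik : i - 1 ≤ k) (hkl : k < l) (hlj : l ≤ j + 1)
    (he : Edge T (Pt.lower k) (Pt.lower l)) {t : Finset (Pt A)} (ht : IsTriangle T t)
    (hsub : ∀ x ∈ t, Pt.lower k ≤ x ∧ x ≤ Pt.lower l) :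
    ∃ m : Set.Icc i j, k < m ∧ m < l ∧ f m = t := by
  induction n generalizing k l t with
  | zero => push_cast at hn; omega
  | succ n ih =>
    push_cast at hn
    have c := @edge_not_cross A T hT.1
    rcases (Int.add_one_le_iff.2 hkl).eq_or_lt with h | h
    · subst h
      have : t ⊆ {Pt.lower k, Pt.lower (k + 1)} := by
        intro x hx
        obtain ⟨h₁, h₂⟩ := hsub x hx
        obtain ⟨m, rfl⟩ := exists_eq_lower h₁ h₂
        simp only [lower_le_lower] at h₁ h₂
        rcases h₁.eq_or_lt with rfl | h₁
        · simp
        · obtain rfl : m = k + 1 := by omega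
          simp
      have := (Finset.card_le_card this).trans Finset.card_le_two
      rw [ht.1] at this
      omega
    · obtain ⟨m, hkm, hml, ekm, eml⟩ := exists_below hT he h
      have hkm' : (Pt.lower k : Pt A) < Pt.lower m := by simpa
      have hml' : (Pt.lower m : Pt A) < Pt.lower l := by simpa
      -- a triangle between `k` and `l` lies left of `m`, right of `m`, or is the one at `m`
      have key : ∀ s : Finset (Pt A), IsTriangle T s →
          (∀ x ∈ s, Pt.lower k ≤ x ∧ x ≤ Pt.lower l) →
          (∀ x ∈ s, Pt.lower k ≤ x ∧ x ≤ Pt.lower m) ∨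
          (∀ x ∈ s, Pt.lower m ≤ x ∧ x ≤ Pt.lower l) ∨
          s = {Pt.lower k, Pt.lower l, Pt.lower m} := by
        intro s hs hss
        by_cases hleft : ∀ x ∈ s, x ≤ Pt.lower m
        · exact Or.inl fun x hx => ⟨(hss x hx).1, hleft x hx⟩
        by_cases hright : ∀ x ∈ s, Pt.lower m ≤ x
        · exact Or.inr (Or.inl fun x hx => ⟨hright x hx, (hss x hx).2⟩)
        push Not at hleft hright
        obtain ⟨z, hz, hmz⟩ := hleft
        obtain ⟨x, hx, hxm⟩ := hright
        have exz := hs.edge hx hz (hxm.trans hmz).ne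
        have hxk : Pt.lower k = x := (hss x hx).1.eq_or_lt.resolve_right
          fun h => c ekm exz h hxm hmz
        have hzl : z = Pt.lower l := (hss z hz).2.eq_or_lt.resolve_right
          fun h => c exz eml hxm hmz h
        subst hxk hzl
        obtain ⟨y, hyk, hyl, rfl⟩ := hs.exists_third hx hz (hxm.trans hmz).ne
        have hy := hss y (by simp)
        rw [below_unique hT.1 (hy.1.lt_of_ne' hyk) (hy.2.lt_of_ne hyl) hkm' hml'
          (hs.edge hx (by simp) hyk.symm) (hs.edge (by simp) hz hyl) ekm eml]
        exact Or.inr (Or.inr rfl)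
      -- The bounds `i - 1 ≤ k` and `l ≤ j + 1` put the apex `m`, strictly between `k` and `l`,
      -- among the matched vertices.
      let m' : Set.Icc i j := ⟨m, by constructor <;> omega⟩
      have hm' : ∀ x ∈ f m', Pt.lower k ≤ x ∧ x ≤ Pt.lower l := by
        intro x hx
        by_cases hxm : x = Pt.lower m
        · subst hxm; exact ⟨hkm'.le, hml'.le⟩
        have e := (hf.2 m').1.edge (hf.2 m').2 hx (Ne.symm hxm)
        exact ⟨le_of_not_gt fun hv => c e.symm he hv hkm' hml',
          le_of_not_gt fun hv => c he e hkm' hml' hv⟩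
      -- By induction the triangles under the two shorter edges are taken by vertices other than
      -- `m`, so only the triangle `k, m, l` is left for `m`.
      have hfm : f m' = {Pt.lower k, Pt.lower l, Pt.lower m} := by
        rcases key _ (hf.2 m').1 hm' with h | h | h
        · obtain ⟨p, -, hp, hpf⟩ := ih (by omega) hik hkm (by omega) ekm (hf.2 m').1 h
          rw [hf.1 hpf] at hp
          exact absurd hp (lt_irrefl _)
        · obtain ⟨p, hp, -, hpf⟩ := ih (by omega) (by omega) hml hlj eml (hf.2 m').1 h
          rw [hf.1 hpf] at hp
          exact absurd hp (lt_irrefl _)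
        · exact h
      rcases key t ht hsub with h | h | h
      · obtain ⟨p, h₁, h₂, h₃⟩ := ih (by omega) hik hkm (by omega) ekm ht h
        exact ⟨p, h₁, h₂.trans hml, h₃⟩
      · obtain ⟨p, h₁, h₂, h₃⟩ := ih (by omega) (by omega) hml hlj eml ht h
        exact ⟨p, hkm.trans h₁, h₂, h₃⟩
      · exact ⟨m', hkm, hml, hfm.trans h.symm⟩

/-- The triangle matched to `k` does not lie below an edge from `k` to a later vertex `l`. -/
theorem matched_not_below (hT : IsAdmissibleTriangulation T) {i j : ℤ}
    {f : Set.Icc i j → Finset (Pt A)} (hf : f ∈ matchings T i j) {k l : Set.Icc i j}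
    (hkl : k < l) (he : Edge T (Pt.lower k) (Pt.lower l)) :
    ¬ ∀ x ∈ f k, Pt.lower k ≤ x ∧ x ≤ Pt.lower (l : ℤ) := by
  intro h
  obtain ⟨m, hm, -, hfm⟩ := exists_matched_of_below hT hf (l - k : ℤ).toNat (by omega)
    (by have := k.2.1; omega) hkl (by have := l.2.2; omega) he (hf.2 k).1 h
  rw [hf.1 hfm] at hm
  exact lt_irrefl _ hm

/-- If `l < l'`, the triangle `g p` has a corner strictly under the edge from `p` to `l'`, so all of
it lies below that edge, where every triangle is already taken by a vertex other than `p`. -/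
theorem not_lt_of_matchings (hT : IsAdmissibleTriangulation T) {i j : ℤ}
    {f g : Set.Icc i j → Finset (Pt A)} (hf : f ∈ matchings T i j) (hg : g ∈ matchings T i j)
    {p l l' : Set.Icc i j} (hpl : p < l) (hl : Pt.lower (l : ℤ) ∈ g p)
    (hl' : Pt.lower (l' : ℤ) ∈ f p) : ¬ l < l' := by
  intro hll
  have c := @edge_not_cross A T hT.1
  have hpl' : (Pt.lower (p : ℤ) : Pt A) < Pt.lower l := by simpa using hpl
  have hll' : (Pt.lower (l : ℤ) : Pt A) < Pt.lower l' := by simpa using hll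
  have e' := (hf.2 p).1.edge (hf.2 p).2 hl' (hpl'.trans hll').ne
  refine matched_not_below hT hg (hpl.trans hll) e' fun x hx => ?_
  by_cases hxl : x = Pt.lower (l : ℤ)
  · subst hxl; exact ⟨hpl'.le, hll'.le⟩
  have e := (hg.2 p).1.edge hl hx (Ne.symm hxl)
  exact ⟨le_of_not_gt fun hv => c e.symm e' hv hpl' hll',
    le_of_not_gt fun hv => c e' e hpl' hll' hv⟩

/-- A matching is determined by the set of triangles it uses. -/
theorem perm_eq_one_of_matchings (hT : IsAdmissibleTriangulation T) {i j : ℤ}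
    {f : Set.Icc i j → Finset (Pt A)} (hf : f ∈ matchings T i j) (σ : Equiv.Perm (Set.Icc i j))
    (hσ : f ∘ σ ∈ matchings T i j) : σ = 1 := by
  by_contra hne
  have hex : {k | σ k ≠ k}.Nonempty := by
    by_contra h
    rw [Set.not_nonempty_iff_eq_empty, Set.eq_empty_iff_forall_notMem] at h
    exact hne (Equiv.ext fun k => by simpa using h k)
  -- At the least moved vertex `p`, both `σ p` and `σ.symm p` lie to the right. The two matchings
  -- give `p` distinct triangles, one containing `σ p` and the other `σ.symm p`.
  obtain ⟨p, hp, hmin⟩ := Set.exists_min_image _ id (Set.toFinite _) hex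
  have hp' : σ p ≠ p := hp
  have h₁ : p < σ p := lt_of_le_of_ne (hmin (σ p) fun h => hp' (σ.injective h)) hp'.symm
  have h₂ : p < σ.symm p := by
    refine lt_of_le_of_ne (hmin (σ.symm p) fun h => hp' ?_) fun h => hp' ?_
    · rw [Equiv.apply_symm_apply] at h
      exact (Equiv.eq_symm_apply σ).1 h
    · nth_rewrite 1 [h]; simp
  have hl : Pt.lower ((σ p : Set.Icc i j) : ℤ) ∈ (f ∘ σ) p := (hf.2 (σ p)).2
  have hl' : Pt.lower ((σ.symm p : Set.Icc i j) : ℤ) ∈ f p := by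
    simpa using (hσ.2 (σ.symm p)).2
  have heq : σ p = σ.symm p := le_antisymm
    (not_lt.1 (not_lt_of_matchings hT hσ hf h₂ hl' hl))
    (not_lt.1 (not_lt_of_matchings hT hf hσ h₁ hl hl'))
  rw [← heq] at hl'
  have hlt : (Pt.lower (p : ℤ) : Pt A) < Pt.lower (σ p : Set.Icc i j) := by simpa using h₁
  have he := (hf.2 p).1.edge (hf.2 p).2 hl' hlt.ne
  -- Both triangles of `p` contain the same edge and neither lies below it, so they coincide,
  -- against injectivity of `f`.
  exact hp' (hf.1 (triangle_above_unique hT.1 hlt (hf.2 p).1 (hσ.2 p).1 (hf.2 p).2 hl' (hσ.2 p).2 hl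
    (matched_not_below hT hf h₁ he) (matched_not_below hT hσ h₁ he))).symm

/-! ### Signed incidences and the Gram matrix -/

open Classical in
/-- The sign of a lower vertex in a triangle: `-1` if it is the middle corner, `1` if it is another
corner, `0` if it is not a corner. -/
noncomputable def cornerSign (k : ℤ) (t : Finset (Pt A)) : ℤ :=
  if Pt.lower k ∈ t then
    if (∃ x ∈ t, x < Pt.lower k) ∧ ∃ z ∈ t, Pt.lower k < z then -1 else 1
  else 0

theorem cornerSign_mul_self {k : ℤ} {t : Finset (Pt A)} (h : Pt.lower k ∈ t) :
    cornerSign k t * cornerSign k t = 1 := by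
  unfold cornerSign; rw [if_pos h]; split_ifs <;> rfl

theorem mem_of_cornerSign_ne_zero {k : ℤ} {t : Finset (Pt A)} (h : cornerSign k t ≠ 0) :
    Pt.lower k ∈ t := by
  by_contra hk
  exact h (if_neg hk)

theorem cornerSign_mul_above {k l : ℤ} (hkl : k < l) {y : Pt A}
    (hy : y < Pt.lower k ∨ Pt.lower l < y) :
    cornerSign k {Pt.lower k, Pt.lower l, y} * cornerSign l {Pt.lower k, Pt.lower l, y} = -1 := by
  have hlt : (Pt.lower k : Pt A) < Pt.lower l := by simpa
  rcases hy with hy | hy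
  · have h₁ := hy.trans hlt
    simp [cornerSign, hkl, hy, h₁, h₁.not_gt, hkl.not_gt]
  · have h₁ := hlt.trans hy
    simp [cornerSign, hkl, hy, h₁, h₁.not_gt, hkl.not_gt]

theorem cornerSign_mul_below {k l : ℤ} (hkl : k < l) {y : Pt A}
    (hy₁ : Pt.lower k < y) (hy₂ : y < Pt.lower l) :
    cornerSign k {Pt.lower k, Pt.lower l, y} * cornerSign l {Pt.lower k, Pt.lower l, y} = 1 := by
  simp [cornerSign, hkl, hy₁, hy₂, hy₁.not_gt, hy₂.not_gt, hkl.not_gt]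

/-- `F` need only contain the common triangles of `k` and `l`, so the triangles at either vertex may
serve; this covers both sides of the diagonal. -/
theorem sum_cornerSign_mul (hT : IsAdmissibleTriangulation T) {k l : ℤ} (hkl : k < l)
    {F : Finset (Finset (Pt A))}
    (hF : ∀ t, IsTriangle T t → Pt.lower k ∈ t → Pt.lower l ∈ t → t ∈ F)
    (hF' : ∀ t ∈ F, IsTriangle T t) :
    ∑ t ∈ F, cornerSign k t * cornerSign l t = if k + 1 = l then -1 else 0 := by
  have hlt : (Pt.lower k : Pt A) < Pt.lower l := by simpa
  have hzero : ∀ t : Finset (Pt A), ¬ (Pt.lower k ∈ t ∧ Pt.lower l ∈ t) →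
      cornerSign k t * cornerSign l t = 0 := by
    intro t ht
    by_contra h
    exact ht ⟨mem_of_cornerSign_ne_zero (left_ne_zero_of_mul h),
      mem_of_cornerSign_ne_zero (right_ne_zero_of_mul h)⟩
  by_cases he : Edge T (Pt.lower k) (Pt.lower l)
  · obtain ⟨y, hy, eky, ely⟩ := exists_above hT he hkl
    have htri := isTriangle_of_edges hT.1 he eky ely
    have huniq : ∀ t ∈ F, Pt.lower k ∈ t → Pt.lower l ∈ t →
        ¬ (∀ x ∈ t, Pt.lower k ≤ x ∧ x ≤ Pt.lower l) → t = {Pt.lower k, Pt.lower l, y} := by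
      intro t ht hk hl hn
      refine triangle_above_unique hT.1 hlt (hF' t ht) htri hk hl (by simp) (by simp) hn ?_
      intro h
      have := h y (by simp)
      rcases hy with hy | hy
      · exact absurd this.1 (not_le.2 hy)
      · exact absurd this.2 (not_le.2 hy)
    have hmem := hF _ htri (by simp) (by simp)
    by_cases hadj : k + 1 = l
    · rw [if_pos hadj, Finset.sum_eq_single_of_mem _ hmem, cornerSign_mul_above hkl hy]
      intro t ht hne
      apply hzero
      rintro ⟨hk, hl⟩
      apply hne
      apply huniq t ht hk hl
      intro hall
      obtain ⟨z, hzk, hzl, rfl⟩ := (hF' t ht).exists_third hk hl hlt.ne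
      have hz := hall z (by simp)
      obtain ⟨m, rfl⟩ := exists_eq_lower hz.1 hz.2
      simp only [lower_le_lower] at hz
      have h₁ : m ≠ k := fun h => hzk (by rw [h])
      have h₂ : m ≠ l := fun h => hzl (by rw [h])
      omega
    · obtain ⟨m, hkm, hml, ekm, eml⟩ := exists_below hT he (by omega)
      have hkm' : (Pt.lower k : Pt A) < Pt.lower m := by simpa
      have hml' : (Pt.lower m : Pt A) < Pt.lower l := by simpa
      have hmem' := hF _ (isTriangle_of_edges hT.1 he ekm eml.symm) (by simp) (by simp)
      rw [if_neg hadj, Finset.sum_eq_add_of_mem _ _ hmem hmem', cornerSign_mul_above hkl hy,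
        cornerSign_mul_below hkl hkm' hml']
      · rfl
      · intro h
        have : y ∈ ({Pt.lower k, Pt.lower l, Pt.lower m} : Finset (Pt A)) := by
          rw [← h]; simp
        simp only [Finset.mem_insert, Finset.mem_singleton] at this
        rcases hy with hy | hy <;> rcases this with rfl | rfl | rfl <;>
          simp only [lower_lt_lower] at hy <;> omega
      · rintro t ht ⟨hne, hne'⟩
        apply hzero
        rintro ⟨hk, hl⟩
        refine hne (huniq t ht hk hl fun hall => hne' ?_)
        have hs := hF' t ht
        obtain ⟨z, hzk, hzl, rfl⟩ := hs.exists_third hk hl hlt.ne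
        have hz := hall z (by simp)
        rw [below_unique hT.1 (hz.1.lt_of_ne' hzk) (hz.2.lt_of_ne hzl) hkm' hml'
          (hs.edge hk (by simp) hzk.symm) (hs.edge (by simp) hl hzl) ekm eml]
  · have hadj : k + 1 ≠ l := by
      rintro rfl
      exact he (edge_succ k)
    rw [if_neg hadj]
    refine Finset.sum_eq_zero fun t ht => hzero t ?_
    rintro ⟨hk, hl⟩
    exact he ((hF' t ht).edge hk hl hlt.ne)

/-! ### Existence and number of matchings -/

/-- Each vertex takes a triangle of which it is the middle corner; a triangle has only one middle
corner, so the choice is injective. -/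
theorem matchings_nonempty (hT : IsAdmissibleTriangulation T) (i j : ℤ) :
    (matchings T i j).Nonempty := by
  choose x z hx hz e₁ e₂ e₃ using exists_middle hT
  refine ⟨fun k => {x k, Pt.lower (k : ℤ), z k}, ?_,
    fun k => ⟨isTriangle_of_edges hT.1 (e₁ _) (e₃ _) (e₂ _), by simp⟩⟩
  have key : ∀ k l : ℤ, k < l → ({x k, Pt.lower k, z k} : Finset (Pt A)) ≠
      {x l, Pt.lower l, z l} := by
    intro k l hkl h
    have hlt : (Pt.lower k : Pt A) < Pt.lower l := by simpa
    have h₁ : x k ∈ ({x l, Pt.lower l, z l} : Finset (Pt A)) := by rw [← h]; simp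
    have h₂ : Pt.lower k ∈ ({x l, Pt.lower l, z l} : Finset (Pt A)) := by rw [← h]; simp
    have hk := hx k
    have hl := hz l
    simp only [Finset.mem_insert, Finset.mem_singleton] at h₁ h₂
    have h₃ : Pt.lower k = x l := by
      rcases h₂ with h₂ | h₂ | h₂
      · exact h₂
      · exact absurd h₂ hlt.ne
      · exact absurd h₂ (hlt.trans hl).ne
    rw [h₃] at hk hlt
    rcases h₁ with h₁ | h₁ | h₁ <;> rw [h₁] at hk
    · exact lt_irrefl _ hk
    · exact lt_asymm hk hlt
    · exact lt_asymm hk (hlt.trans hl)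
  intro k l h
  rcases lt_trichotomy (k : ℤ) l with hkl | hkl | hkl
  · exact absurd h (key _ _ hkl)
  · exact Subtype.ext hkl
  · exact absurd h.symm (key _ _ hkl)

theorem finite_matchings (hT : IsAdmissibleTriangulation T) (i j : ℤ) :
    (matchings T i j).Finite :=
  (Set.Finite.pi fun k : Set.Icc i j => finite_trianglesAt hT k).subset fun _ hf k _ => hf.2 k

/-- The vertices `i, …, i + n - 1`, counted from `0`. -/
def finEquivIcc (i j : ℤ) (n : ℕ) (h : i + n = j + 1) : Fin n ≃ Set.Icc i j where
  toFun p := ⟨i + (p : ℕ), by constructor <;> omega⟩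
  invFun k := ⟨(k - i : ℤ).toNat, by have := k.2.1; have := k.2.2; omega⟩
  left_inv p := by ext; simp
  right_inv k := by ext; have := k.2.1; simp; omega

theorem ncard_matchings (hT : IsAdmissibleTriangulation T) (i j : ℤ) (n : ℕ) (h : i + n = j + 1) :
    ((matchings T i j).ncard : ℤ) =
      (tridiagonal (fun k => ((trianglesAt T k).ncard : ℤ)) i n).det := by
  classical
  let F : Set.Icc i j → Finset (Finset (Pt A)) := fun k => (finite_trianglesAt hT k).toFinset
  have hF : ∀ k t, t ∈ F k ↔ t ∈ trianglesAt T k := fun k t => by simp [F]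
  have hdet := det_gram_eq_card (fun (k : Set.Icc i j) t => cornerSign (k : ℤ) t) F
    (fun k t ht => cornerSign_mul_self ((hF k t).1 ht).2) ?_ ?_
  · have hset : matchings T i j =
        ↑(Finset.filter (fun f => Function.Injective f) (Fintype.piFinset F)) := by
      ext f
      simp only [matchings, Set.mem_ofPred_eq, Finset.coe_filter, Fintype.mem_piFinset, hF]
      exact and_comm
    rw [hset, Set.ncard_coe_finset, ← hdet,
      ← Matrix.det_submatrix_equiv_self (finEquivIcc i j n h)]
    congr 1
    ext p q
    have hF' : ∀ (p : Fin n) t, t ∈ F (finEquivIcc i j n h p) ↔ t ∈ trianglesAt T (i + (p : ℕ)) :=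
      fun p => hF (finEquivIcc i j n h p)
    have hsum : ∀ p q : Fin n, (p : ℕ) < q →
        ∑ t ∈ F (finEquivIcc i j n h p), cornerSign (i + (p : ℕ)) t * cornerSign (i + (q : ℕ)) t =
          if (p : ℕ) + 1 = q then -1 else 0 := by
      intro p q hpq
      rw [sum_cornerSign_mul hT (by omega) (fun t ht hp _ => (hF' _ _).2 ⟨ht, hp⟩)
        fun t ht => ((hF' _ _).1 ht).1]
      exact if_congr (by omega) rfl rfl
    have hsum' : ∀ p q : Fin n, (q : ℕ) < p →
        ∑ t ∈ F (finEquivIcc i j n h p), cornerSign (i + (p : ℕ)) t * cornerSign (i + (q : ℕ)) t =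
          if (q : ℕ) + 1 = p then -1 else 0 := by
      intro p q hpq
      simp_rw [mul_comm (cornerSign (i + (p : ℕ)) _)]
      rw [sum_cornerSign_mul hT (by omega) (fun t ht _ hp => (hF' _ _).2 ⟨ht, hp⟩)
        fun t ht => ((hF' _ _).1 ht).1]
      exact if_congr (by omega) rfl rfl
    change (∑ t ∈ F (finEquivIcc i j n h p),
      cornerSign (i + (p : ℕ)) t * cornerSign (i + (q : ℕ)) t) = _
    rw [tridiagonal, Matrix.of_apply]
    rcases lt_trichotomy p q with hpq | rfl | hpq
    · rw [hsum p q hpq, if_neg hpq.ne]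
      exact if_congr (by omega) rfl rfl
    · rw [if_pos rfl, Finset.sum_congr rfl fun t ht => cornerSign_mul_self ((hF' _ _).1 ht).2,
        Finset.sum_const, nsmul_one, Set.ncard_eq_toFinset_card _ (finite_trianglesAt hT _)]
      rfl
    · rw [hsum' p q hpq, if_neg hpq.ne']
      exact if_congr (by omega) rfl rfl
  · intro k l t ht h
    exact (hF _ _).2 ⟨((hF _ _).1 ht).1, mem_of_cornerSign_ne_zero h⟩
  · intro f hinj hf σ hσ
    exact perm_eq_one_of_matchings hT ⟨hinj, fun k => (hF _ _).1 (hf k)⟩ σ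
      ⟨hinj.comp σ.injective, fun k => (hF _ _).1 (hσ k)⟩

/-! ### The frieze of matching numbers -/

/-- The entries of an infinite frieze are determined by its quiddity row. -/
theorem IsInfiniteFrieze.unique {m m' : ℤ → ℤ → ℤ} (hm : IsInfiniteFrieze m)
    (hm' : IsInfiniteFrieze m') (h : ∀ i, m i i = m' i i) (n : ℕ) (i : ℤ) :
    m i (i + n) = m' i (i + n) := by
  induction n using Nat.strong_induction_on generalizing i with
  | _ n ih =>
    rcases n with _ | _ | n
    · simpa using h i
    · have h₁ := hm.2.2.2 i i (by omega)
      have h₂ := hm'.2.2.2 i i (by omega)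
      have e₁ := hm.2.1 (i + 1)
      have e₂ := hm'.2.1 (i + 1)
      rw [add_sub_cancel_right] at e₁ e₂
      rw [e₁, h, h] at h₁
      rw [e₂] at h₂
      push_cast
      linarith
    · have h₁ := hm.2.2.2 i (i + (n + 1 : ℕ)) (by push_cast; omega)
      have h₂ := hm'.2.2.2 i (i + (n + 1 : ℕ)) (by push_cast; omega)
      have e₁ := ih (n + 1) (by omega) i
      have e₂ := ih (n + 1) (by omega) (i + 1)
      have e₃ := ih n (by omega) (i + 1)
      have hpos := hm'.2.2.1 (i + 1) (i + 1 + n) (by omega)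
      rw [show i + ((n + 1 : ℕ) : ℤ) + 1 = i + 1 + (n + 1 : ℕ) by ring] at h₁ h₂
      rw [show i + ((n + 1 + 1 : ℕ) : ℤ) = i + 1 + (n + 1 : ℕ) by push_cast; ring]
      have e : i + ((n + 1 : ℕ) : ℤ) = i + 1 + n := by push_cast; ring
      rw [e₁, e₂, e, e₃] at h₁
      rw [e] at h₂
      -- The frieze rule fixes the new entry up to the factor two rows earlier, which is positive
      -- and cancels.
      exact mul_left_cancel₀ hpos.ne' (by linarith)

/-- The numbers of matchings, extended by a row of ones and a row of zeros. -/
noncomputable def matchingFrieze (T : Set (Sym2 (Pt A))) (i j : ℤ) : ℤ :=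
  if i - 1 ≤ j then ((matchings T i j).ncard : ℤ) else 0

theorem matchingFrieze_of_le {i j : ℤ} (h : i ≤ j) :
    matchingFrieze T i j = ((matchings T i j).ncard : ℤ) := if_pos (by omega)

theorem matchingFrieze_eq_det (hT : IsAdmissibleTriangulation T) {i j : ℤ} {n : ℕ}
    (h : i + n = j + 1) : matchingFrieze T i j =
      (tridiagonal (fun k => ((trianglesAt T k).ncard : ℤ)) i n).det := by
  rw [matchingFrieze, if_pos (by omega), ncard_matchings hT i j n h]

theorem isQuiddityRow_matchingFrieze (hT : IsAdmissibleTriangulation T) :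
    IsQuiddityRow (matchingFrieze T) fun i => ((trianglesAt T i).ncard : ℤ) := by
  intro i
  rw [matchingFrieze_eq_det hT (n := 1) (by simp), det_tridiagonal_one]

theorem isInfiniteFrieze_matchingFrieze (hT : IsAdmissibleTriangulation T) :
    IsInfiniteFrieze (matchingFrieze T) := by
  refine ⟨fun i => if_neg (by omega), fun i => ?_, fun i j hij => ?_, fun i j hij => ?_⟩
  · rw [matchingFrieze_eq_det hT (n := 0) (by simp), det_tridiagonal_zero]
  · rw [matchingFrieze_of_le hij]
    exact_mod_cast (Set.ncard_pos (finite_matchings hT i j)).2 (matchings_nonempty hT i j)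
  -- For `j = i - 1` the rule involves the row of zeros, which is not a determinant, and is checked
  -- apart.
  · rcases hij.eq_or_lt with rfl | hij
    · have h₁ : matchingFrieze T (i + 1) (i - 1) = 0 := if_neg (by omega)
      rw [h₁, matchingFrieze_eq_det hT (i := i) (j := i - 1) (n := 0) (by simp),
        matchingFrieze_eq_det hT (i := i + 1) (j := i - 1 + 1) (n := 0) (by simp),
        det_tridiagonal_zero, det_tridiagonal_zero]
      norm_num
    · obtain ⟨n, rfl⟩ : ∃ n : ℕ, j = i + n := ⟨(j - i).toNat, by omega⟩
      rw [matchingFrieze_eq_det hT (i := i) (j := i + n) (n := n + 1) (by push_cast; ring),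
        matchingFrieze_eq_det hT (i := i + 1) (j := i + n + 1) (n := n + 1) (by push_cast; ring),
        matchingFrieze_eq_det hT (i := i + 1) (j := i + n) (n := n) (by ring),
        matchingFrieze_eq_det hT (i := i) (j := i + n + 1) (n := n + 2) (by push_cast; ring)]
      exact det_tridiagonal_unimodular _ n i

end InfiniteStrip

theorem theorem5p6 (A : Set ℚ) (T : Set (Sym2 (InfiniteStrip.Pt A)))
    (hT : InfiniteStrip.IsAdmissibleTriangulation T) :
    (∀ i : ℤ, (InfiniteStrip.trianglesAt T i).Finite) ∧
    (∀ i j : ℤ, i ≤ j → (InfiniteStrip.matchings T i j).Finite) ∧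
    (∃ m : ℤ → ℤ → ℤ, InfiniteStrip.IsInfiniteFrieze m ∧
      InfiniteStrip.IsQuiddityRow m (fun i => ((InfiniteStrip.trianglesAt T i).ncard : ℤ))) ∧
    (∀ m : ℤ → ℤ → ℤ, InfiniteStrip.IsInfiniteFrieze m →
      InfiniteStrip.IsQuiddityRow m (fun i => ((InfiniteStrip.trianglesAt T i).ncard : ℤ)) →
      ∀ i j : ℤ, i ≤ j → m i j = ((InfiniteStrip.matchings T i j).ncard : ℤ)) := by
  refine ⟨InfiniteStrip.finite_trianglesAt hT, fun i j _ => InfiniteStrip.finite_matchings hT i j,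
    ⟨InfiniteStrip.matchingFrieze T, InfiniteStrip.isInfiniteFrieze_matchingFrieze hT,
      InfiniteStrip.isQuiddityRow_matchingFrieze hT⟩, fun m hm hq i j hij => ?_⟩
  rw [← InfiniteStrip.matchingFrieze_of_le hij]
  obtain ⟨n, rfl⟩ : ∃ n : ℕ, j = i + n := ⟨(j - i).toNat, by omega⟩
  exact hm.unique (InfiniteStrip.isInfiniteFrieze_matchingFrieze hT)
    (fun k => (hq k).trans (InfiniteStrip.isQuiddityRow_matchingFrieze hT k).symm) n i
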